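/- Let $(x^1,x^2,p^1,p^2)$ be coordinates on $\mathbb{R}^4$ and let subscripts denote partial derivatives. For smooth functions $u,v$ on an open set of $\mathbb{R}^4$ put \[ r = v_{x^2p^1}-v_{x^1p^2}+u_{p^2}v_{p^1p^1}+(v_{p^2}-u_{p^1})v_{p^1p^2}-v_{p^1}v_{p^2p^2}, \] \[ s = u_{x^1p^2}-u_{x^2p^1}-u_{p^2}u_{p^1p^1}+(u_{p^1}-v_{p^2})u_{p^1p^2}+v_{p^1}u_{p^2p^2}, \] and consider the (case-3) system \[ u_{p^1p^2}=0,\quad v_{p^1p^2}=0,\quad rs=0,\quad v_{p^1}s_{p^2}+s_{x^1}=0,\quad u_{p^2}r_{p^1}+r_{x^2}=0,\quad s_{p^1}=0,\quad r_{p^2}=0. \qquad (*) \] The cone structure corresponding to $(u,v)$ assigns to each point $q$ the cone $\mathcal{C}_q=\bigcup_{\lambda\in\mathbb{R}}\operatorname{span}\{Y_0(\lambda),Y_1(\lambda)\}$ in the tangent space at $q$, where \[ Y_0=(\cos\lambda)\partial_{p^1}+(\sin\lambda)(\partial_{x^1}+u_{p^1}\partial_{p^1}+v_{p^1}\partial_{p^2}),\qquad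 Y_1=(\cosh\lambda)\partial_{p^2}+(\sinh\lambda)(\partial_{x^2}+u_{p^2}\partial_{p^1}+v_{p^2}\partial_{p^2}). \] The linear system $\ddot x=-x$, $\ddot y=y$ defines a cone structure on its solution space, which is identified with $\mathbb{R}^4$ by $(x^1,x^2,p^1,p^2)=(x(0),y(0),\dot x(0),\dot y(0))$: the cone at a solution is the union over $t_0\in\mathbb{R}$ of the tangent planes at this solution to the surface of all solutions that agree with it at time $t_0$. It is called the flat cone structure. A diffeomorphism of cone structures is a smooth diffeomorphism whose differential maps the cone at each point onto the cone at the image point. Let $U,V\subset\mathbb{R}^2$ be open, let $u=u(x^1,p^1)$ and $v=v(x^2,p^2)$ be arbitrary smooth functions on $U$ and $V$ respectively, and regard them as functions on $M=\{(x^1,x^2,p^1,p^2) : (x^1,p^1)\in U,\ (x^2,p^2)\in V\}$. Then: 1. $(u,v)$ solves $(*)$ on $M$. 2. The cone structure corresponding to $u=v=0$ on $\mathbb{R}^4$ is the flat one. 3. If $W\subset M$ is open and $u_{p^1p^1p^1}\neq 0$ or $v_{p^2p^2p^2}\neq 0$ at some point of $W$, then the cone structure corresponding to $(u,v)$ on $W$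 is not diffeomorphic to the restriction of the flat cone structure to any open subset of $\mathbb{R}^4$. -/

import Mathlib

open scoped ContDiff

namespace ConeGeom

/-- Coordinate space with coordinates `(x¹, x², p¹, p²)`, indexed by `0, 1, 2, 3`. -/
abbrev R4 : Type := Fin 4 → ℝ

/-- Index of the coordinate `x¹`. -/
abbrev x1 : Fin 4 := 0
/-- Index of the coordinate `x²`. -/
abbrev x2 : Fin 4 := 1
/-- Index of the coordinate `p¹`. -/
abbrev p1 : Fin 4 := 2
/-- Index of the coordinate `p²`. -/
abbrev p2 : Fin 4 := 3

/-- The coordinate vector field `∂_i`. -/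
def basisVec (i : Fin 4) : R4 := Pi.single i 1

/-- The partial derivative of `f` in the direction of the `i`-th coordinate. -/
noncomputable def pd (i : Fin 4) (f : R4 → ℝ) (q : R4) : ℝ := fderiv ℝ f q (basisVec i)

/-- `r = v_{x²p¹} - v_{x¹p²} + u_{p²} v_{p¹p¹} + (v_{p²} - u_{p¹}) v_{p¹p²} - v_{p¹} v_{p²p²}`. -/
noncomputable def rFun (u v : R4 → ℝ) (q : R4) : ℝ :=
  pd p1 (pd x2 v) q - pd p2 (pd x1 v) q + pd p2 u q * pd p1 (pd p1 v) q
    + (pd p2 v q - pd p1 u q) * pd p2 (pd p1 v) q - pd p1 v q * pd p2 (pd p2 v) q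

/-- `s = u_{x¹p²} - u_{x²p¹} - u_{p²} u_{p¹p¹} + (u_{p¹} - v_{p²}) u_{p¹p²} + v_{p¹} u_{p²p²}`. -/
noncomputable def sFun (u v : R4 → ℝ) (q : R4) : ℝ :=
  pd p2 (pd x1 u) q - pd p1 (pd x2 u) q - pd p2 u q * pd p1 (pd p1 u) q
    + (pd p1 u q - pd p2 v q) * pd p2 (pd p1 u) q + pd p1 v q * pd p2 (pd p2 u) q

/-- `(u, v)` solves the case-3 system on `M`. -/
structure SolvesCase3 (M : Set R4) (u v : R4 → ℝ) : Prop where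
  u_p1p2 : ∀ q ∈ M, pd p2 (pd p1 u) q = 0
  v_p1p2 : ∀ q ∈ M, pd p2 (pd p1 v) q = 0
  rs : ∀ q ∈ M, rFun u v q * sFun u v q = 0
  s_x1 : ∀ q ∈ M, pd p1 v q * pd p2 (sFun u v) q + pd x1 (sFun u v) q = 0
  r_x2 : ∀ q ∈ M, pd p2 u q * pd p1 (rFun u v) q + pd x2 (rFun u v) q = 0
  s_p1 : ∀ q ∈ M, pd p1 (sFun u v) q = 0
  r_p2 : ∀ q ∈ M, pd p2 (rFun u v) q = 0

/-- A field of cones: to each point a subset of the tangent space at that point. -/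
abbrev ConeField : Type := R4 → Set R4

/-- `Y₀ = cos τ ∂_{p¹} + sin τ (∂_{x¹} + u_{p¹} ∂_{p¹} + v_{p¹} ∂_{p²})`,
where `τ` is the spectral parameter. -/
noncomputable def Y0 (u v : R4 → ℝ) (τ : ℝ) (q : R4) : R4 :=
  Real.cos τ • basisVec p1
    + Real.sin τ • (basisVec x1 + pd p1 u q • basisVec p1 + pd p1 v q • basisVec p2)

/-- `Y₁ = cosh τ ∂_{p²} + sinh τ (∂_{x²} + u_{p²} ∂_{p¹} + v_{p²} ∂_{p²})`. -/
noncomputable def Y1 (u v : R4 → ℝ) (τ : ℝ) (q : R4) : R4 :=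
  Real.cosh τ • basisVec p2
    + Real.sinh τ • (basisVec x2 + pd p2 u q • basisVec p1 + pd p2 v q • basisVec p2)

/-- The cone structure of `(u, v)`: the cone at `q` is the union over all `τ` of the
planes spanned by `Y₀` and `Y₁`. -/
def coneOf (u v : R4 → ℝ) : ConeField := fun q =>
  {w | ∃ τ : ℝ, w ∈ Submodule.span ℝ {Y0 u v τ q, Y1 u v τ q}}

/-- `(x, y)` is a solution of the linear system `ẍ = -x`, `ÿ = y`. -/
def IsLinearSolution (x y : ℝ → ℝ) : Prop :=
  ContDiff ℝ 2 x ∧ ContDiff ℝ 2 y ∧ ∀ t, deriv (deriv x) t = -x t ∧ deriv (deriv y) t = y t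

/-- Initial data `(x(0), y(0), ẋ(0), ẏ(0))`; on solutions of the linear system these are
global coordinates on the solution space. -/
noncomputable def initialData (x y : ℝ → ℝ) : R4 := ![x 0, y 0, deriv x 0, deriv y 0]

/-- The cone structure that the linear system `ẍ = -x`, `ÿ = y` defines on its solution space,
in the coordinates `initialData`: a tangent vector `w` at the solution `q` lies in the cone if
it is the velocity at `ε = 0` of a curve `ε ↦ (x ε, y ε)` of solutions that starts at `q` and all of
whose members take one and the same value at some time `t₀`. So the cone at `q` is the union of the
tangent planes of the surfaces formed by the solutions through a point of the graph of `q`. -/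
def linearSystemCone : ConeField := fun q =>
  {w | ∃ (t₀ : ℝ) (x y : ℝ → ℝ → ℝ),
    (∀ ε, IsLinearSolution (x ε) (y ε)) ∧
    initialData (x 0) (y 0) = q ∧
    HasDerivAt (fun ε => initialData (x ε) (y ε)) w 0 ∧
    ∀ ε, x ε t₀ = x 0 t₀ ∧ y ε t₀ = y 0 t₀}

/-- The cone structures `C` on the open set `W` and `C'` on the open set `W'` are diffeomorphic:
a smooth diffeomorphism `W → W'` maps the cone at each point onto the cone at the image point. -/
def ConesDiffeomorphic (W : Set R4) (C : ConeField) (W' : Set R4) (C' : ConeField) : Prop :=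
  ∃ φ ψ : R4 → R4,
    ContDiffOn ℝ ∞ φ W ∧ ContDiffOn ℝ ∞ ψ W' ∧
    Set.MapsTo φ W W' ∧ Set.MapsTo ψ W' W ∧
    Set.LeftInvOn ψ φ W ∧ Set.RightInvOn ψ φ W' ∧
    ∀ q ∈ W, fderiv ℝ φ q '' C q = C' (φ q)

end ConeGeom

/-! The system holds because the derivatives across the two variable pairs vanish, which makes r and
s identically zero. The flat cone is the linear system's cone because evaluation at a time t₀ is
linear in the initial data: fixing both values at t₀ puts the velocity in the generating plane with
τ = -t₀.

Non-flatness rests on the rigidity of the flat cone. Its only planes are its generators and the (x¹,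
p¹)-plane (`plane_of_inFlat`), so a linear automorphism permutes the generators and fixes that
plane. Comparing with the images of the generators, it also fixes the (x², p²)-plane, and it acts on
the two factors by conformal maps with one common angle c, sending the generator τ to c ± τ
(`exists_angle_of_automorphism`).

The cone of (u, v) is a shear of the flat one, so a diffeomorphism to the flat structure is
conformal in this sense at every point (`isConformalAt_of_image`). Its components split into
functions of (x¹, p¹) and of (x², p²), up to locally constant choices. The angle can be read off
from either pair, hence has zero differential (`angle_pd_eq_zero`). Undoing the now locally constant
angle leaves, in each factor, functions X, P with X_p = 0, P_x + a P_p = 0 and X_x² = P_p² ≠ 0,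
where a is u_{p¹} or v_{p²}. Then P_p does not depend on p, so a is affine in p (`pd_pd_eq_zero`):
the third derivative vanishes. -/

namespace ConeGeom

/-! ### Planes contained in the flat cone -/

/-- `w` lies in the plane of the flat cone with spectral parameter `τ`. -/
def InPlane (τ : ℝ) (w : R4) : Prop :=
  w 0 * Real.cos τ = w 2 * Real.sin τ ∧ w 1 * Real.cosh τ = w 3 * Real.sinh τ

/-- `w` lies in the flat cone. -/
def InFlat (w : R4) : Prop := ∃ τ, InPlane τ w

/-- The unit vector of the plane with parameter `τ` in the `(x¹, p¹)`-factor. -/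
noncomputable def circVec (τ : ℝ) : R4 := ![Real.sin τ, 0, Real.cos τ, 0]

/-- The unit vector of the plane with parameter `τ` in the `(x², p²)`-factor. -/
noncomputable def hypVec (τ : ℝ) : R4 := ![0, Real.sinh τ, 0, Real.cosh τ]

theorem circVec_eq (τ : ℝ) :
    circVec τ = Real.sin τ • basisVec 0 + Real.cos τ • basisVec 2 := by
  ext i; fin_cases i <;> simp [circVec, basisVec]

theorem hypVec_eq (τ : ℝ) :
    hypVec τ = Real.sinh τ • basisVec 1 + Real.cosh τ • basisVec 3 := by
  ext i; fin_cases i <;> simp [hypVec, basisVec]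

theorem inPlane_span (τ s t : ℝ) : InPlane τ (s • circVec τ + t • hypVec τ) := by
  constructor <;> simp [circVec, hypVec] <;> ring

theorem eq_of_sinh_mul_cosh {σ τ : ℝ} (h : Real.sinh σ * Real.cosh τ = Real.cosh σ * Real.sinh τ) :
    σ = τ := by
  have : Real.sinh (σ - τ) = 0 := by rw [Real.sinh_sub]; linarith
  rw [Real.sinh_eq_zero] at this
  linarith

/-- Injectivity of tanh: a nonzero (x², p²)-part already determines the generator. -/
theorem eq_of_hyp {y q σ τ : ℝ} (hq : q ≠ 0) (h₁ : y * Real.cosh σ = q * Real.sinh σ)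
    (h₂ : y * Real.cosh τ = q * Real.sinh τ) : σ = τ := by
  apply eq_of_sinh_mul_cosh
  apply mul_left_cancel₀ hq
  linear_combination Real.cosh σ * h₂ - Real.cosh τ * h₁

theorem eq_zero_of_hyp {y q τ : ℝ} (h : y * Real.cosh τ = q * Real.sinh τ) (hq : q = 0) :
    y = 0 := by
  rw [hq, zero_mul] at h
  exact (mul_eq_zero.1 h).resolve_right (Real.cosh_pos τ).ne'

/-- The `(x², p²)`-parts of the vectors of a plane inside the flat cone are proportional. -/
theorem det_eq_zero_of_inFlat {v w : R4} (h : ∀ s t : ℝ, InFlat (s • v + t • w)) :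
    v 1 * w 3 - v 3 * w 1 = 0 := by
  -- This combination has p²-coordinate zero, and in the flat cone that forces the x²-coordinate to
  -- vanish too.
  obtain ⟨τ, -, hτ⟩ := h (w 3) (-v 3)
  simp only [Pi.add_apply, Pi.smul_apply, smul_eq_mul] at hτ
  have := eq_zero_of_hyp hτ (by ring)
  linarith

/-- A plane inside the flat cone is either the `(x¹, p¹)`-plane or one of its generators. -/
theorem plane_of_inFlat {v w : R4} (h : ∀ s t : ℝ, InFlat (s • v + t • w)) :
    (v 1 = 0 ∧ v 3 = 0 ∧ w 1 = 0 ∧ w 3 = 0) ∨ ∃ τ, InPlane τ v ∧ InPlane τ w := by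
  have key : ∀ {v w : R4}, (∀ s t : ℝ, InFlat (s • v + t • w)) → v 3 ≠ 0 →
      ∃ τ, InPlane τ v ∧ InPlane τ w := by
    intro v w h hv
    obtain ⟨τ, hτ⟩ := h 1 0
    rw [one_smul, zero_smul, add_zero] at hτ
    have hd := det_eq_zero_of_inFlat h
    -- The coefficients make the (x², p²)-part equal to `v 3` times that of `v`, so this vector lies
    -- in the same generator as `v`; removing the multiple of `v` leaves `w`.
    obtain ⟨σ, hσ⟩ := h (v 3 - w 3) (v 3)
    have h3 : ((v 3 - w 3) • v + v 3 • w) 3 = v 3 * v 3 := by simp; ring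
    have h1 : ((v 3 - w 3) • v + v 3 • w) 1 = v 1 * v 3 := by
      simp; linear_combination -hd
    have hσ2 := hσ.2
    rw [h3, h1] at hσ2
    obtain rfl : σ = τ := eq_of_hyp hv
      (mul_left_cancel₀ hv (by linear_combination hσ2)) hτ.2
    refine ⟨σ, hτ, mul_left_cancel₀ hv ?_, mul_left_cancel₀ hv ?_⟩
    · have := hσ.1
      simp only [Pi.add_apply, Pi.smul_apply, smul_eq_mul] at this
      linear_combination this - (v 3 - w 3) * hτ.1
    · linear_combination (-Real.cosh σ) * hd + w 3 * hτ.2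
  by_cases hv : v 3 = 0
  · by_cases hw : w 3 = 0
    · left
      obtain ⟨τ, hτ⟩ := h 1 0
      obtain ⟨σ, hσ⟩ := h 0 1
      rw [one_smul, zero_smul, add_zero] at hτ
      rw [one_smul, zero_smul, zero_add] at hσ
      exact ⟨eq_zero_of_hyp hτ.2 hv, hv, eq_zero_of_hyp hσ.2 hw, hw⟩
    · obtain ⟨τ, h₁, h₂⟩ := key (v := w) (w := v) (fun s t => by rw [add_comm]; exact h t s) hw
      exact Or.inr ⟨τ, h₂, h₁⟩
  · exact Or.inr (key h hv)

/-- The directions (sin τ, cos τ) exhaust all lines of the (x¹, p¹)-plane, whereas (sinh τ, cosh τ)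
only reaches timelike lines. This asymmetry distinguishes the two factors. -/
theorem inFlat_of_fst {w : R4} (h1 : w 1 = 0) (h3 : w 3 = 0) : InFlat w := by
  by_cases h : w 2 = 0
  · exact ⟨Real.pi / 2, by simp [h], by simp [h1, h3]⟩
  · refine ⟨Real.arctan (w 0 / w 2), ?_, by simp [h1, h3]⟩
    have hc := (Real.cos_arctan_pos (w 0 / w 2)).ne'
    have ht := Real.tan_arctan (w 0 / w 2)
    rw [Real.tan_eq_sin_div_cos, div_eq_div_iff hc h] at ht
    linarith

theorem hyp_iff {y q : ℝ} : (∃ τ, y * Real.cosh τ = q * Real.sinh τ) ↔ (y = 0 ∧ q = 0) ∨ |y| < |q| := by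
  constructor
  · rintro ⟨τ, h⟩
    by_cases hq : q = 0
    · exact Or.inl ⟨eq_zero_of_hyp h hq, hq⟩
    · right
      rw [← sq_lt_sq]
      have hc := Real.cosh_pos τ
      have hs := Real.cosh_sq τ
      have : y ^ 2 * Real.cosh τ ^ 2 = q ^ 2 * Real.sinh τ ^ 2 := by
        rw [← mul_pow, h, mul_pow]
      have hq2 : 0 < q ^ 2 := by positivity
      by_contra! hle
      nlinarith [mul_le_mul_of_nonneg_right hle (sq_nonneg (Real.cosh τ))]
  · rintro (⟨rfl, rfl⟩ | h)
    · exact ⟨0, by simp⟩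
    · have hq : q ≠ 0 := by rintro rfl; simp at h; exact absurd h (not_lt.2 (abs_nonneg y))
      have hm : y / q ∈ Set.Ioo (-1 : ℝ) 1 := by
        rw [Set.mem_Ioo, ← abs_lt, abs_div, div_lt_one (abs_pos.2 hq)]; exact h
      refine ⟨Real.artanh (y / q), ?_⟩
      have ht := Real.tanh_artanh hm
      rw [Real.tanh_eq_sinh_div_cosh, div_eq_div_iff (Real.cosh_pos _).ne' hq] at ht
      linarith

theorem inFlat_of_snd {w : R4} (h0 : w 0 = 0) (h2 : w 2 = 0) :
    InFlat w ↔ (w 1 = 0 ∧ w 3 = 0) ∨ |w 1| < |w 3| := by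
  rw [← hyp_iff]
  simp [InFlat, InPlane, h0, h2]

/-! ### Linear automorphisms of the flat cone -/

section Automorphisms

variable {L M : R4 →ₗ[ℝ] R4}

/-- Linear automorphisms of the flat cone preserve the `(x¹, p¹)`-plane. -/
theorem map_fst_of_automorphism (hLM : ∀ w, L (M w) = w)
    (hL : ∀ w, InFlat (L w) ↔ InFlat w) {w : R4} (h1 : w 1 = 0) (h3 : w 3 = 0) :
    L w 1 = 0 ∧ L w 3 = 0 := by
  have hM : ∀ w, InFlat (M w) ↔ InFlat w := fun w => by rw [← hL, hLM]
  have hw : ∀ w : R4, w 1 = 0 → w 3 = 0 → w = w 0 • basisVec 0 + w 2 • basisVec 2 := by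
    intro w h1 h3
    ext i; fin_cases i <;> simp [basisVec, h1, h3]
  have hflat : ∀ s t : ℝ, InFlat (s • L (basisVec 0) + t • L (basisVec 2)) := by
    intro s t
    rw [← map_smul, ← map_smul, ← map_add, hL]
    exact inFlat_of_fst (by simp [basisVec]) (by simp [basisVec])
  rcases plane_of_inFlat hflat with ⟨a, b, c, d⟩ | ⟨σ, hσ0, hσ2⟩
  · rw [hw w h1 h3, map_add, map_smul, map_smul]
    simp [a, b, c, d]
  -- Suppose the image lies in the generator σ. The preimage of the generator σ + 1 is a plane in
  -- the flat cone, and by the determinant identity it meets the (x¹, p¹)-plane nontrivially. The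
  -- image of a common vector lies in both generators, which intersect only in 0 since sin 1 and
  -- sinh 1 are nonzero.
  exfalso
  have hσ : ∀ w : R4, w 1 = 0 → w 3 = 0 → InPlane σ (L w) := by
    intro w h1 h3
    rw [hw w h1 h3, map_add, map_smul, map_smul]
    simp only [InPlane, Pi.add_apply, Pi.smul_apply, smul_eq_mul] at hσ0 hσ2 ⊢
    constructor
    · linear_combination w 0 * hσ0.1 + w 2 * hσ2.1
    · linear_combination w 0 * hσ0.2 + w 2 * hσ2.2
  have hflat' : ∀ s t : ℝ, InFlat (s • M (circVec (σ + 1)) + t • M (hypVec (σ + 1))) := by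
    intro s t
    rw [← map_smul, ← map_smul, ← map_add, hM]
    exact ⟨_, inPlane_span _ s t⟩
  have hd := det_eq_zero_of_inFlat hflat'
  set v := M (circVec (σ + 1))
  set z := M (hypVec (σ + 1))
  have trivial_of_mem : ∀ s t : ℝ, (s • v + t • z) 1 = 0 → (s • v + t • z) 3 = 0 →
      s = 0 ∧ t = 0 := by
    intro s t e1 e3
    have := hσ _ e1 e3
    rw [map_add, map_smul, map_smul, hLM, hLM] at this
    simp only [InPlane, circVec, hypVec, Pi.add_apply, Pi.smul_apply, smul_eq_mul] at this
    simp at this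
    constructor
    · have h1 : s * Real.sin (σ + 1 - σ) = 0 := by
        rw [Real.sin_sub]; linarith [this.1]
      refine (mul_eq_zero.1 h1).resolve_right ?_
      rw [add_sub_cancel_left]
      exact (Real.sin_pos_of_pos_of_lt_pi one_pos (by linarith [Real.pi_gt_three])).ne'
    · have h1 : t * Real.sinh (σ + 1 - σ) = 0 := by
        rw [Real.sinh_sub]; linarith [this.2]
      refine (mul_eq_zero.1 h1).resolve_right ?_
      rw [add_sub_cancel_left]
      exact (Real.sinh_pos_iff.2 one_pos).ne'
  have e1 := trivial_of_mem (z 3) (-v 3) (by simp; linear_combination hd) (by simp; ring)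
  have e2 := trivial_of_mem (z 1) (-v 1) (by simp; ring) (by simp; linear_combination -hd)
  have := (trivial_of_mem 1 0 (by simp; linarith [e2.2]) (by simp; linarith [e1.2])).1
  exact one_ne_zero this

/-- Linear automorphisms of the flat cone permute its generating planes. -/
theorem map_plane_of_automorphism (hML : ∀ w, M (L w) = w) (hLM : ∀ w, L (M w) = w)
    (hL : ∀ w, InFlat (L w) ↔ InFlat w) (τ : ℝ) :
    ∃ ρ, InPlane ρ (L (circVec τ)) ∧ InPlane ρ (L (hypVec τ)) := by
  have hM : ∀ w, InFlat (M w) ↔ InFlat w := fun w => by rw [← hL, hLM]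
  have hflat : ∀ s t : ℝ, InFlat (s • L (circVec τ) + t • L (hypVec τ)) := by
    intro s t
    rw [← map_smul, ← map_smul, ← map_add, hL]
    exact ⟨_, inPlane_span _ s t⟩
  refine (plane_of_inFlat hflat).resolve_left ?_
  rintro ⟨-, -, h1, h3⟩
  have := (map_fst_of_automorphism hML hM h1 h3).2
  rw [hML] at this
  simp [hypVec, (Real.cosh_pos τ).ne'] at this

/-- Linear automorphisms of the flat cone preserve the `(x², p²)`-plane. -/
theorem map_snd_of_automorphism (hML : ∀ w, M (L w) = w) (hLM : ∀ w, L (M w) = w)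
    (hL : ∀ w, InFlat (L w) ↔ InFlat w) {w : R4} (h0 : w 0 = 0) (h2 : w 2 = 0) :
    L w 0 = 0 ∧ L w 2 = 0 := by
  have hcross : ∀ τ, L (circVec τ) 0 * L (hypVec τ) 2 - L (circVec τ) 2 * L (hypVec τ) 0 = 0 := by
    intro τ
    obtain ⟨ρ, ⟨h₁, -⟩, ⟨h₂, -⟩⟩ := map_plane_of_automorphism hML hLM hL τ
    have a : Real.sin ρ * (L (circVec τ) 0 * L (hypVec τ) 2
        - L (circVec τ) 2 * L (hypVec τ) 0) = 0 := by
      linear_combination (-L (circVec τ) 0) * h₂ + L (hypVec τ) 0 * h₁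
    have b : Real.cos ρ * (L (circVec τ) 0 * L (hypVec τ) 2
        - L (circVec τ) 2 * L (hypVec τ) 0) = 0 := by
      linear_combination (-L (circVec τ) 2) * h₂ + L (hypVec τ) 2 * h₁
    linear_combination Real.sin ρ * a + Real.cos ρ * b
      - (L (circVec τ) 0 * L (hypVec τ) 2 - L (circVec τ) 2 * L (hypVec τ) 0)
        * Real.sin_sq_add_cos_sq ρ
  -- The cross product is a combination of cos·cosh, cos·sinh, sin·cosh and sin·sinh; the samples 0,
  -- π, ±π/2 isolate its four coefficients. So the (x¹, p¹)-parts of the images of ∂_{x²} and ∂_{p²}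
  -- are parallel to two independent vectors, hence zero.
  have d0 := hcross 0
  have dpi := hcross Real.pi
  have d2 := hcross (Real.pi / 2)
  have d2' := hcross (-(Real.pi / 2))
  simp only [circVec_eq, hypVec_eq, map_add, map_smul, Pi.add_apply, Pi.smul_apply, smul_eq_mul,
    Real.sin_zero, Real.cos_zero, Real.sinh_zero, Real.cosh_zero, Real.sin_pi, Real.cos_pi,
    Real.sin_pi_div_two, Real.cos_pi_div_two, Real.sin_neg, Real.cos_neg, Real.sinh_neg,
    Real.cosh_neg] at d0 dpi d2 d2'
  have hpi : Real.sinh Real.pi ≠ 0 := (Real.sinh_pos_iff.2 Real.pi_pos).ne'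
  have hpi2 : Real.sinh (Real.pi / 2) ≠ 0 := (Real.sinh_pos_iff.2 (by positivity)).ne'
  have hcpi2 : Real.cosh (Real.pi / 2) ≠ 0 := (Real.cosh_pos _).ne'
  have c23 : L (basisVec 2) 0 * L (basisVec 3) 2 - L (basisVec 2) 2 * L (basisVec 3) 0 = 0 := by
    linear_combination d0
  have c21 : L (basisVec 2) 0 * L (basisVec 1) 2 - L (basisVec 2) 2 * L (basisVec 1) 0 = 0 := by
    apply mul_left_cancel₀ hpi
    linear_combination -dpi - Real.cosh Real.pi * c23
  have c01 : L (basisVec 0) 0 * L (basisVec 1) 2 - L (basisVec 0) 2 * L (basisVec 1) 0 = 0 := by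
    apply mul_left_cancel₀ hpi2
    linear_combination (1 / 2) * d2 + (1 / 2) * d2'
  have c03 : L (basisVec 0) 0 * L (basisVec 3) 2 - L (basisVec 0) 2 * L (basisVec 3) 0 = 0 := by
    apply mul_left_cancel₀ hcpi2
    linear_combination (1 / 2) * d2 - (1 / 2) * d2'
  have hinj : ∀ s t : ℝ, s * L (basisVec 0) 0 + t * L (basisVec 2) 0 = 0 →
      s * L (basisVec 0) 2 + t * L (basisVec 2) 2 = 0 → s = 0 ∧ t = 0 := by
    intro s t e0 e2
    have hz : L (s • basisVec 0 + t • basisVec 2) = 0 := by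
      have := map_fst_of_automorphism hLM hL (w := s • basisVec 0 + t • basisVec 2)
        (by simp [basisVec]) (by simp [basisVec])
      ext i
      fin_cases i
      · simpa using e0
      · exact this.1
      · simpa using e2
      · exact this.2
    have hz' := hML (s • basisVec 0 + t • basisVec 2)
    rw [hz, map_zero] at hz'
    constructor
    · simpa [basisVec] using (congrFun hz' 0).symm
    · simpa [basisVec] using (congrFun hz' 2).symm
  have hdet : L (basisVec 0) 0 * L (basisVec 2) 2 - L (basisVec 2) 0 * L (basisVec 0) 2 ≠ 0 := by
    intro hd
    have a := hinj (L (basisVec 2) 2) (-L (basisVec 0) 2) (by linear_combination hd) (by ring)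
    have b := hinj (L (basisVec 2) 0) (-L (basisVec 0) 0) (by ring) (by linear_combination -hd)
    exact one_ne_zero (hinj 1 0 (by linarith [b.2]) (by linarith [a.2])).1
  have z10 : L (basisVec 1) 0 = 0 := by
    apply mul_left_cancel₀ hdet
    linear_combination L (basisVec 2) 0 * c01 - L (basisVec 0) 0 * c21
  have z12 : L (basisVec 1) 2 = 0 := by
    apply mul_left_cancel₀ hdet
    linear_combination L (basisVec 2) 2 * c01 - L (basisVec 0) 2 * c21
  have z30 : L (basisVec 3) 0 = 0 := by
    apply mul_left_cancel₀ hdet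
    linear_combination L (basisVec 2) 0 * c03 - L (basisVec 0) 0 * c23
  have z32 : L (basisVec 3) 2 = 0 := by
    apply mul_left_cancel₀ hdet
    linear_combination L (basisVec 2) 2 * c03 - L (basisVec 0) 2 * c23
  have hw : w = w 1 • basisVec 1 + w 3 • basisVec 3 := by
    ext i; fin_cases i <;> simp [basisVec, h0, h2]
  rw [hw, map_add, map_smul, map_smul]
  simp [z10, z12, z30, z32]

/-- Linear automorphisms of the flat cone map null vectors of the `(x², p²)`-plane to null
vectors. -/
theorem null_of_automorphism (hML : ∀ w, M (L w) = w) (hLM : ∀ w, L (M w) = w)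
    (hL : ∀ w, InFlat (L w) ↔ InFlat w) {ε : ℝ} (hε : ε ^ 2 = 1) :
    (ε * L (basisVec 1) 1 + L (basisVec 3) 1) ^ 2 =
      (ε * L (basisVec 1) 3 + L (basisVec 3) 3) ^ 2 := by
  have hflat : ∀ t : ℝ, InFlat (t • basisVec 1 + basisVec 3) ↔ |t| < 1 := by
    intro t
    rw [inFlat_of_snd (by simp [basisVec]) (by simp [basisVec])]
    simp [basisVec]
  have hL' : ∀ t : ℝ, |t| < 1 ↔ (t * L (basisVec 1) 1 + L (basisVec 3) 1 = 0 ∧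
      t * L (basisVec 1) 3 + L (basisVec 3) 3 = 0) ∨
      |t * L (basisVec 1) 1 + L (basisVec 3) 1| < |t * L (basisVec 1) 3 + L (basisVec 3) 3| := by
    intro t
    obtain ⟨e0, e2⟩ := map_snd_of_automorphism hML hLM hL (w := t • basisVec 1 + basisVec 3)
      (by simp [basisVec]) (by simp [basisVec])
    rw [← hflat, ← hL, inFlat_of_snd e0 e2]
    simp
  have hε1 : |ε| = 1 := by
    rw [← abs_one, ← sq_eq_sq_iff_abs_eq_abs]; simpa using hε
  apply le_antisymm
  -- One inequality is the limit from timelike vectors inside the cone; the other holds because the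
  -- null vector itself lies outside it.
  · have hlim : ∀ t ∈ Set.Iio (1 : ℝ), 0 < t →
        ((t * ε) * L (basisVec 1) 1 + L (basisVec 3) 1) ^ 2
          ≤ ((t * ε) * L (basisVec 1) 3 + L (basisVec 3) 3) ^ 2 := by
      intro t ht ht0
      rcases (hL' (t * ε)).1 (by rw [abs_mul, hε1, abs_of_pos ht0, mul_one]; exact ht) with h | h
      · rw [h.1, h.2]
      · exact (sq_lt_sq.2 h).le
    have hev : ∀ᶠ t in nhdsWithin (1 : ℝ) (Set.Iio 1),
        ((t * ε) * L (basisVec 1) 1 + L (basisVec 3) 1) ^ 2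
          ≤ ((t * ε) * L (basisVec 1) 3 + L (basisVec 3) 3) ^ 2 := by
      filter_upwards [self_mem_nhdsWithin, mem_nhdsWithin_of_mem_nhds (lt_mem_nhds one_pos)]
        with t h1 h2 using hlim t h1 h2
    have c1 : Filter.Tendsto (fun t : ℝ => ((t * ε) * L (basisVec 1) 1 + L (basisVec 3) 1) ^ 2)
        (nhdsWithin 1 (Set.Iio 1)) (nhds (((1 * ε) * L (basisVec 1) 1 + L (basisVec 3) 1) ^ 2)) :=
      Filter.Tendsto.mono_left (Continuous.tendsto (by fun_prop) 1) nhdsWithin_le_nhds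
    have c2 : Filter.Tendsto (fun t : ℝ => ((t * ε) * L (basisVec 1) 3 + L (basisVec 3) 3) ^ 2)
        (nhdsWithin 1 (Set.Iio 1)) (nhds (((1 * ε) * L (basisVec 1) 3 + L (basisVec 3) 3) ^ 2)) :=
      Filter.Tendsto.mono_left (Continuous.tendsto (by fun_prop) 1) nhdsWithin_le_nhds
    simpa using le_of_tendsto_of_tendsto c1 c2 hev
  · have := (hL' ε).not.1 (by rw [hε1]; exact lt_irrefl 1)
    push Not at this
    exact sq_le_sq.2 this.2

/-- The linear automorphisms of the flat cone: a conformal map of the Euclidean factor and a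
conformal map of the Lorentzian factor, with the same angle. -/
theorem exists_angle_of_automorphism (hML : ∀ w, M (L w) = w) (hLM : ∀ w, L (M w) = w)
    (hL : ∀ w, InFlat (L w) ↔ InFlat w) :
    ∃ c k l k' l' : ℝ, k ≠ 0 ∧ l ≠ 0 ∧ k' ^ 2 = k ^ 2 ∧ l' ^ 2 = l ^ 2 ∧
      L (basisVec 2) = k • circVec c ∧
      L (basisVec 0) = k' • circVec (c + Real.pi / 2) ∧
      L (basisVec 3) = l • hypVec c ∧
      L (basisVec 1) = l' • ![0, Real.cosh c, 0, Real.sinh c] := by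
  have hM : ∀ w, InFlat (M w) ↔ InFlat w := fun w => by rw [← hL, hLM]
  have hplane := map_plane_of_automorphism hML hLM hL
  have hfst0 := map_fst_of_automorphism hLM hL (w := basisVec 0) (by simp [basisVec])
    (by simp [basisVec])
  have hfst2 := map_fst_of_automorphism hLM hL (w := basisVec 2) (by simp [basisVec])
    (by simp [basisVec])
  have hsnd1 := map_snd_of_automorphism hML hLM hL (w := basisVec 1) (by simp [basisVec])
    (by simp [basisVec])
  have hsnd3 := map_snd_of_automorphism hML hLM hL (w := basisVec 3) (by simp [basisVec])
    (by simp [basisVec])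
  have hn1 := null_of_automorphism hML hLM hL (ε := 1) (by norm_num)
  have hn2 := null_of_automorphism hML hLM hL (ε := -1) (by norm_num)
  -- The common angle is the parameter of the image of the generator τ = 0.
  obtain ⟨c, hcA, hcB⟩ := hplane 0
  have he0 : circVec 0 = basisVec 2 := by simp [circVec_eq]
  have hh0 : hypVec 0 = basisVec 3 := by simp [hypVec_eq]
  rw [he0] at hcA
  rw [hh0] at hcB
  have hcA := hcA.1
  have hcB := hcB.2
  have hcs := Real.sin_sq_add_cos_sq c
  have hch := Real.cosh_sq c
  have hinj : ∀ w, L w = 0 → w = 0 := fun w h => by rw [← hML w, h, map_zero]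
  -- the image of `∂_{p¹}`
  obtain ⟨k, hk⟩ : ∃ k : ℝ, L (basisVec 2) = k • circVec c := by
    refine ⟨Real.sin c * L (basisVec 2) 0 + Real.cos c * L (basisVec 2) 2, ?_⟩
    ext i; fin_cases i
    · simp [circVec]; linear_combination (-L (basisVec 2) 0) * hcs + Real.cos c * hcA
    · simp [circVec, hfst2.1]
    · simp [circVec]; linear_combination (-L (basisVec 2) 2) * hcs - Real.sin c * hcA
    · simp [circVec, hfst2.2]
  have hk0 : k ≠ 0 := by
    rintro rfl
    have := congrFun (hinj _ (hk.trans (zero_smul ℝ _))) 2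
    simp [basisVec] at this
  -- the image of `∂_{p²}`
  obtain ⟨l, hl⟩ : ∃ l : ℝ, L (basisVec 3) = l • hypVec c := by
    refine ⟨Real.cosh c * L (basisVec 3) 3 - Real.sinh c * L (basisVec 3) 1, ?_⟩
    ext i; fin_cases i
    · simp [hypVec, hsnd3.1]
    · simp [hypVec]; linear_combination (-L (basisVec 3) 1) * hch + Real.cosh c * hcB
    · simp [hypVec, hsnd3.2]
    · simp [hypVec]; linear_combination (-L (basisVec 3) 3) * hch + Real.sinh c * hcB
  have hl0 : l ≠ 0 := by
    rintro rfl
    have := congrFun (hinj _ (hl.trans (zero_smul ℝ _))) 3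
    simp [basisVec] at this
  have hl1 : L (basisVec 3) 1 = l * Real.sinh c := by rw [hl]; simp [hypVec]
  have hl3 : L (basisVec 3) 3 = l * Real.cosh c := by rw [hl]; simp [hypVec]
  -- The difference of the two null conditions says that the images of ∂_{x²} and ∂_{p²} are
  -- Lorentz-orthogonal.
  have hcross : L (basisVec 1) 1 * Real.sinh c = L (basisVec 1) 3 * Real.cosh c := by
    rw [hl1, hl3] at hn1 hn2
    apply mul_left_cancel₀ hl0
    linear_combination (1 / 4) * hn1 - (1 / 4) * hn2
  -- the image of `∂_{x²}`
  obtain ⟨l', hl'⟩ : ∃ l' : ℝ, L (basisVec 1) = l' • ![0, Real.cosh c, 0, Real.sinh c] := by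
    refine ⟨Real.cosh c * L (basisVec 1) 1 - Real.sinh c * L (basisVec 1) 3, ?_⟩
    ext i; fin_cases i
    · simp [hsnd1.1]
    · simp; linear_combination (-L (basisVec 1) 1) * hch - Real.sinh c * hcross
    · simp [hsnd1.2]
    · simp; linear_combination (-L (basisVec 1) 3) * hch - Real.cosh c * hcross
  have hl'1 : L (basisVec 1) 1 = l' * Real.cosh c := by rw [hl']; simp
  have hl'3 : L (basisVec 1) 3 = l' * Real.sinh c := by rw [hl']; simp
  have hll : l' ^ 2 = l ^ 2 := by
    rw [hl1, hl3, hl'1, hl'3] at hn1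
    linear_combination hn1 + (l ^ 2 - l' ^ 2) * hch
  -- the planes are permuted by `τ ↦ ± τ + c`
  obtain ⟨s, hs, hsl⟩ : ∃ s : ℝ, (s = 1 ∨ s = -1) ∧ l' = s * l := by
    rcases sq_eq_sq_iff_eq_or_eq_neg.1 hll with h | h
    · exact ⟨1, Or.inl rfl, by simp [h]⟩
    · exact ⟨-1, Or.inr rfl, by simp [h]⟩
  have hsh : ∀ τ, Real.sinh (s * τ) = s * Real.sinh τ ∧ Real.cosh (s * τ) = Real.cosh τ := by
    intro τ
    rcases hs with rfl | rfl <;> simp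
  have hρ : ∀ τ, InPlane (c + s * τ) (L (circVec τ)) := by
    intro τ
    obtain ⟨ρ, h₁, -, h₂⟩ := hplane τ
    suffices ρ = c + s * τ by rw [← this]; exact h₁
    rw [hypVec_eq, map_add, map_smul, map_smul] at h₂
    simp only [Pi.add_apply, Pi.smul_apply, smul_eq_mul, hl1, hl3, hl'1, hl'3, hsl] at h₂
    symm
    apply eq_of_sinh_mul_cosh
    apply mul_left_cancel₀ hl0
    rw [Real.sinh_add, Real.cosh_add, (hsh τ).1, (hsh τ).2]
    linear_combination h₂
  have hk00 : L (basisVec 2) 0 = k * Real.sin c := by rw [hk]; simp [circVec]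
  have hk2 : L (basisVec 2) 2 = k * Real.cos c := by rw [hk]; simp [circVec]
  have hA : L (basisVec 0) 0 * -Real.sin c = L (basisVec 0) 2 * Real.cos c := by
    have h := (hρ (Real.pi / 2)).1
    rw [show circVec (Real.pi / 2) = basisVec 0 by simp [circVec_eq]] at h
    rw [Real.cos_add, Real.sin_add] at h
    rcases hs with rfl | rfl
    · simp at h; linarith
    · simp at h; linarith
  obtain ⟨k', hk'⟩ : ∃ k' : ℝ, L (basisVec 0) = k' • circVec (c + Real.pi / 2) := by
    refine ⟨Real.cos c * L (basisVec 0) 0 - Real.sin c * L (basisVec 0) 2, ?_⟩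
    ext i; fin_cases i
    · simp [circVec, Real.sin_add_pi_div_two]
      linear_combination (-L (basisVec 0) 0) * hcs - Real.sin c * hA
    · simp [circVec, hfst0.1]
    · simp [circVec, Real.cos_add_pi_div_two]
      linear_combination (-L (basisVec 0) 2) * hcs - Real.cos c * hA
    · simp [circVec, hfst0.2]
  have hk'0 : L (basisVec 0) 0 = k' * Real.cos c := by
    rw [hk']; simp [circVec, Real.sin_add_pi_div_two]
  have hk'2 : L (basisVec 0) 2 = -(k' * Real.sin c) := by
    rw [hk']; simp [circVec, Real.cos_add_pi_div_two]
  -- The generator π/2 has fixed the line of the image of ∂_{x¹}; the generator π/4, containing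
  -- ∂_{x¹} + ∂_{p¹}, fixes the ratio of the scalings.
  have hkk : k' ^ 2 = k ^ 2 := by
    have h := (hρ (Real.pi / 4)).1
    have hsq : Real.sqrt 2 / 2 ≠ 0 := by positivity
    rw [circVec_eq, map_add, map_smul, map_smul] at h
    simp only [Pi.add_apply, Pi.smul_apply, smul_eq_mul, hk00, hk2, hk'0, hk'2, Real.sin_add,
      Real.cos_add, Real.sin_pi_div_four, Real.cos_pi_div_four] at h
    rcases hs with rfl | rfl
    · simp only [one_mul, Real.sin_pi_div_four, Real.cos_pi_div_four] at h
      have : k' = k := by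
        apply mul_left_cancel₀ (pow_ne_zero 2 hsq)
        linear_combination h - (Real.sqrt 2 / 2) ^ 2 * (k' - k) * hcs
      rw [this]
    · simp only [neg_mul, one_mul, Real.sin_neg, Real.cos_neg, Real.sin_pi_div_four,
        Real.cos_pi_div_four] at h
      have : k' = -k := by
        apply mul_left_cancel₀ (pow_ne_zero 2 hsq)
        linear_combination h - (Real.sqrt 2 / 2) ^ 2 * (k' + k) * hcs
      rw [this, neg_sq]
  exact ⟨c, k, l, k', l', hk0, hl0, hkk, hll, hk, hk', hl, hl'⟩

end Automorphisms

/-! ### Calculus of partial derivatives -/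

section PartialDerivatives

variable {N : Set R4} {f g : R4 → ℝ} {q : R4}

theorem pd_contDiffOn (hN : IsOpen N) (hf : ContDiffOn ℝ ∞ f N) (i : Fin 4) :
    ContDiffOn ℝ ∞ (pd i f) N :=
  (hf.fderiv_of_isOpen hN (by simp)).clm_apply contDiffOn_const

theorem differentiableAt_of_contDiffOn (hN : IsOpen N) (hf : ContDiffOn ℝ ∞ f N) (hq : q ∈ N) :
    DifferentiableAt ℝ f q :=
  (hf.contDiffAt (hN.mem_nhds hq)).differentiableAt (by simp)

theorem pd_comm (hN : IsOpen N) (hf : ContDiffOn ℝ ∞ f N) (hq : q ∈ N) (i j : Fin 4) :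
    pd i (pd j f) q = pd j (pd i f) q := by
  have hc := hf.contDiffAt (hN.mem_nhds hq)
  have hd : DifferentiableAt ℝ (fderiv ℝ f) q :=
    ((hf.fderiv_of_isOpen hN (m := ∞) (by simp)).contDiffAt (hN.mem_nhds hq)).differentiableAt
      (by simp)
  have key : ∀ i j, pd i (pd j f) q = fderiv ℝ (fderiv ℝ f) q (basisVec i) (basisVec j) := by
    intro i j
    have h := hd.hasFDerivAt.clm_apply (hasFDerivAt_const (basisVec j) q)
    have : fderiv ℝ (pd j f) q = _ := h.fderiv
    rw [pd, this]
    simp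
  rw [key, key]
  exact hc.isSymmSndFDerivAt (by simpa using WithTop.coe_le_coe.2 (le_top : (2 : ℕ∞) ≤ ⊤)) _ _

theorem pd_congr (hN : IsOpen N) (h : ∀ q ∈ N, f q = g q) (hq : q ∈ N) (i : Fin 4) :
    pd i f q = pd i g q := by
  have : f =ᶠ[nhds q] g := Filter.eventually_of_mem (hN.mem_nhds hq) h
  rw [pd, pd, this.fderiv_eq]

theorem pd_eq_zero (hN : IsOpen N) (h : ∀ q ∈ N, f q = 0) (hq : q ∈ N) (i : Fin 4) :
    pd i f q = 0 := by
  rw [pd_congr (g := fun _ => 0) hN h hq i]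
  simp [pd]

theorem pd_mul (hf : DifferentiableAt ℝ f q) (hg : DifferentiableAt ℝ g q) (i : Fin 4) :
    pd i (fun q => f q * g q) q = f q * pd i g q + pd i f q * g q := by
  have := (hf.hasFDerivAt.mul hg.hasFDerivAt).fderiv
  have h2 : fderiv ℝ (fun q => f q * g q) q = _ := this
  rw [pd, h2]
  simp [pd]; ring

theorem pd_add (hf : DifferentiableAt ℝ f q) (hg : DifferentiableAt ℝ g q) (i : Fin 4) :
    pd i (fun q => f q + g q) q = pd i f q + pd i g q := by
  have h2 : fderiv ℝ (fun q => f q + g q) q = _ := (hf.hasFDerivAt.add hg.hasFDerivAt).fderiv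
  rw [pd, h2]
  simp [pd]

theorem pd_linearCombination (hf : DifferentiableAt ℝ f q) (hg : DifferentiableAt ℝ g q)
    (s t : ℝ) (i : Fin 4) :
    pd i (fun q => s * f q + t * g q) q = s * pd i f q + t * pd i g q := by
  have h2 : fderiv ℝ (fun q => s * f q + t * g q) q = _ :=
    ((hf.hasFDerivAt.const_mul s).add (hg.hasFDerivAt.const_mul t)).fderiv
  rw [pd, h2]
  simp [pd]

/-- If `X_j = 0`, `P_i + a P_j = 0` and `X_i² = P_j² ≠ 0` near a point, then `a_{jj} = 0`. -/
theorem pd_pd_eq_zero {X P a : R4 → ℝ} {i j : Fin 4} (hN : IsOpen N)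
    (hX : ContDiffOn ℝ ∞ X N) (hP : ContDiffOn ℝ ∞ P N) (ha : ContDiffOn ℝ ∞ a N)
    (hXj : ∀ q ∈ N, pd j X q = 0) (hPi : ∀ q ∈ N, pd i P q + a q * pd j P q = 0)
    (hXP : ∀ q ∈ N, pd i X q ^ 2 = pd j P q ^ 2) (hPj : ∀ q ∈ N, pd j P q ≠ 0)
    (hq : q ∈ N) : pd j (pd j a) q = 0 := by
  have D := fun {f : R4 → ℝ} (hf : ContDiffOn ℝ ∞ f N) {q : R4} (hq : q ∈ N) =>
    differentiableAt_of_contDiffOn hN hf hq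
  have S := fun {f : R4 → ℝ} (hf : ContDiffOn ℝ ∞ f N) (i : Fin 4) => pd_contDiffOn hN hf i
  -- X_i is independent of the j-th variable, hence so is P_j².
  have hPjj : ∀ q ∈ N, pd j (pd j P) q = 0 := by
    intro q hq
    have h1 : pd j (pd i X) q = 0 := by
      rw [pd_comm hN hX hq]; exact pd_eq_zero hN hXj hq i
    have h2 := pd_congr (f := fun q => pd i X q * pd i X q) (g := fun q => pd j P q * pd j P q) hN
      (fun q hq => by linear_combination hXP q hq) hq j
    rw [pd_mul (D (S hX i) hq) (D (S hX i) hq), pd_mul (D (S hP j) hq) (D (S hP j) hq), h1] at h2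
    apply mul_left_cancel₀ (hPj q hq)
    linear_combination (-1 / 2) * h2
  have hE : ∀ q ∈ N, pd j (pd i P) q + pd j a q * pd j P q = 0 := by
    intro q hq
    have h := pd_eq_zero hN hPi hq j
    rw [pd_add (g := fun q => a q * pd j P q) (D (S hP i) hq) ((D ha hq).mul (D (S hP j) hq)),
      pd_mul (D ha hq) (D (S hP j) hq), hPjj q hq] at h
    linear_combination h
  have h := pd_eq_zero hN hE hq j
  have h0 : pd j (pd j (pd i P)) q = 0 := by
    rw [pd_congr hN (fun q hq => pd_comm hN hP hq j i) hq, pd_comm hN (S hP j) hq]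
    exact pd_eq_zero hN hPjj hq i
  rw [pd_add (g := fun q => pd j a q * pd j P q) (D (S (S hP i) j) hq) ((D (S ha j) hq).mul (D (S hP j) hq)),
    pd_mul (D (S ha j) hq) (D (S hP j) hq), hPjj q hq, h0] at h
  exact (mul_eq_zero.1 (by linear_combination h)).resolve_right (hPj q hq)

end PartialDerivatives

/-! ### Conformal maps and the constancy of their angle -/

/-- The map with components `F` sends the frame `∂_{p¹}`, `∂_{x¹} + a ∂_{p¹}`, `∂_{p²}`,
`∂_{x²} + b ∂_{p²}` at `q` to the flat frame, up to scalings and a rotation by the angle `c`. -/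
structure IsConformalAt (F : Fin 4 → R4 → ℝ) (a b : R4 → ℝ) (q : R4) (c k l k' l' : ℝ) :
    Prop where
  k_ne : k ≠ 0
  l_ne : l ≠ 0
  k_sq : k' ^ 2 = k ^ 2
  l_sq : l' ^ 2 = l ^ 2
  pd_p1 : ∀ i, pd 2 (F i) q = (k • circVec c) i
  pd_x1 : ∀ i, pd 0 (F i) q + a q * pd 2 (F i) q = (k' • circVec (c + Real.pi / 2)) i
  pd_p2 : ∀ i, pd 3 (F i) q = (l • hypVec c) i
  pd_x2 : ∀ i, pd 1 (F i) q + b q * pd 3 (F i) q =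
    (l' • ![0, Real.cosh c, 0, Real.sinh c] : R4) i

namespace IsConformalAt

variable {F : Fin 4 → R4 → ℝ} {a b : R4 → ℝ} {q : R4} {c k l k' l' : ℝ}

theorem fst (h : IsConformalAt F a b q c k l k' l') {i : Fin 4} (hi : i = 0 ∨ i = 2) :
    pd 1 (F i) q = 0 ∧ pd 3 (F i) q = 0 := by
  have h2 := h.pd_p2 i
  have h1 := h.pd_x2 i
  rcases hi with rfl | rfl <;> simp [hypVec] at h1 h2 <;> simpa [h2] using h1

theorem snd (h : IsConformalAt F a b q c k l k' l') {i : Fin 4} (hi : i = 1 ∨ i = 3) :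
    pd 0 (F i) q = 0 ∧ pd 2 (F i) q = 0 := by
  have h2 := h.pd_p1 i
  have h1 := h.pd_x1 i
  rcases hi with rfl | rfl <;> simp [circVec] at h1 h2 <;> simpa [h2] using h1

/-- The angle is a function of the first derivatives. -/
theorem angle_eq (h : IsConformalAt F a b q c k l k' l') :
    c = 1 / 2 * (Real.log (pd 3 (F 3) q + pd 3 (F 1) q)
      - Real.log (pd 3 (F 3) q - pd 3 (F 1) q)) := by
  have h1 : pd 3 (F 1) q = l * Real.sinh c := by rw [h.pd_p2]; simp [hypVec]
  have h3 : pd 3 (F 3) q = l * Real.cosh c := by rw [h.pd_p2]; simp [hypVec]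
  -- The arguments become l·exp(±c). `Real.log` is the logarithm of the absolute value, so a
  -- negative l does no harm and cancels.
  rw [h1, h3, ← mul_add, ← mul_sub, Real.cosh_add_sinh, Real.cosh_sub_sinh,
    Real.log_mul h.l_ne (Real.exp_ne_zero _), Real.log_mul h.l_ne (Real.exp_ne_zero _),
    Real.log_exp, Real.log_exp]
  ring

end IsConformalAt

/-- The partial derivatives of the angle vanish. -/
theorem angle_pd_eq_zero {F : Fin 4 → R4 → ℝ} {a b : R4 → ℝ} {W : Set R4} (hW : IsOpen W)
    (hF : ∀ i, ContDiffOn ℝ ∞ (F i) W)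
    {c k l k' l' : R4 → ℝ}
    (h : ∀ q ∈ W, IsConformalAt F a b q (c q) (k q) (l q) (k' q) (l' q)) {q : R4} (hq : q ∈ W) :
    HasFDerivAt c (0 : R4 →L[ℝ] ℝ) q := by
  have hc : c =ᶠ[nhds q] fun q => 1 / 2 * (Real.log (pd 3 (F 3) q + pd 3 (F 1) q)
      - Real.log (pd 3 (F 3) q - pd 3 (F 1) q)) :=
    Filter.eventually_of_mem (hW.mem_nhds hq) fun q hq => (h q hq).angle_eq
  have D : ∀ i j, HasFDerivAt (pd j (F i)) (fderiv ℝ (pd j (F i)) q) q := fun i j =>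
    (differentiableAt_of_contDiffOn hW (pd_contDiffOn hW (hF i) j) hq).hasFDerivAt
  have h1 : pd 3 (F 1) q = l q * Real.sinh (c q) := by rw [(h q hq).pd_p2]; simp [hypVec]
  have h3 : pd 3 (F 3) q = l q * Real.cosh (c q) := by rw [(h q hq).pd_p2]; simp [hypVec]
  have n1 : pd 3 (F 3) q + pd 3 (F 1) q ≠ 0 := by
    rw [h1, h3, ← mul_add, Real.cosh_add_sinh]
    exact mul_ne_zero (h q hq).l_ne (Real.exp_ne_zero _)
  have n2 : pd 3 (F 3) q - pd 3 (F 1) q ≠ 0 := by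
    rw [h1, h3, ← mul_sub, Real.cosh_sub_sinh]
    exact mul_ne_zero (h q hq).l_ne (Real.exp_ne_zero _)
  have hd := (((((D 3 3).add (D 1 3)).log n1).sub (((D 3 3).sub (D 1 3)).log n2)).const_mul
    (1 / 2)).congr_of_eventuallyEq hc
  have hdc := hd.differentiableAt.hasFDerivAt
  -- The formula for c involves only derivatives of F¹ and F³, which do not vary in the x¹ and p¹
  -- directions.
  have hfst : ∀ j, j = 0 ∨ j = 2 → fderiv ℝ c q (basisVec j) = 0 := by
    intro j hj
    have z : ∀ i, i = 1 ∨ i = 3 → fderiv ℝ (pd 3 (F i)) q (basisVec j) = 0 := by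
      intro i hi
      change pd j (pd 3 (F i)) q = 0
      rw [pd_comm hW (hF i) hq]
      refine pd_eq_zero hW (fun q hq => ?_) hq 3
      rcases hj with rfl | rfl
      · exact ((h q hq).snd hi).1
      · exact ((h q hq).snd hi).2
    rw [hd.fderiv]
    simp [z 1 (Or.inl rfl), z 3 (Or.inr rfl)]
  have hsnd : ∀ j, j = 1 ∨ j = 3 → fderiv ℝ c q (basisVec j) = 0 := by
    intro j hj
    have z : ∀ i, i = 0 ∨ i = 2 → fderiv ℝ (pd 2 (F i)) q (basisVec j) = 0 := by
      intro i hi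
      change pd j (pd 2 (F i)) q = 0
      rw [pd_comm hW (hF i) hq]
      refine pd_eq_zero hW (fun q hq => ?_) hq 2
      rcases hj with rfl | rfl
      · exact ((h q hq).fst hi).1
      · exact ((h q hq).fst hi).2
    -- In the x² and p² directions c is controlled by the Euclidean factor instead: differentiating
    -- this relation leaves k times the derivative of c.
    have hz : (fun q => pd 2 (F 0) q * Real.cos (c q) - pd 2 (F 2) q * Real.sin (c q))
        =ᶠ[nhds q] fun _ => 0 := by
      refine Filter.eventually_of_mem (hW.mem_nhds hq) fun q hq => ?_
      simp only [(h q hq).pd_p1]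
      simp [circVec]; ring
    have hzd := (((D 0 2).mul hdc.cos).sub ((D 2 2).mul hdc.sin)).unique
      ((hasFDerivAt_const (0 : ℝ) q).congr_of_eventuallyEq hz)
    have hzj := congrArg (fun T : R4 →L[ℝ] ℝ => T (basisVec j)) hzd
    have e0 : pd 2 (F 0) q = k q * Real.sin (c q) := by rw [(h q hq).pd_p1]; simp [circVec]
    have e2 : pd 2 (F 2) q = k q * Real.cos (c q) := by rw [(h q hq).pd_p1]; simp [circVec]
    simp [z 0 (Or.inl rfl), z 2 (Or.inr rfl), e0, e2] at hzj
    refine mul_left_cancel₀ (h q hq).k_ne ?_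
    linear_combination -hzj
      - k q * fderiv ℝ c q (basisVec j) * Real.sin_sq_add_cos_sq (c q)
  have h0 : fderiv ℝ c q = 0 := by
    ext w
    have hw : w = w 0 • basisVec 0 + w 1 • basisVec 1 + w 2 • basisVec 2 + w 3 • basisVec 3 := by
      ext i; fin_cases i <;> simp [basisVec]
    rw [hw]
    simp only [map_add, map_smul, hfst 0 (Or.inl rfl), hfst 2 (Or.inr rfl), hsnd 1 (Or.inl rfl),
      hsnd 3 (Or.inr rfl)]
    simp
  rwa [h0] at hdc

/-- A map that is conformal in the sense of `IsConformalAt` exists only if `a` and `b` are affine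
in `p¹` and `p²`. -/
theorem pd_pd_eq_zero_of_conformal {F : Fin 4 → R4 → ℝ} {a b : R4 → ℝ} {W : Set R4}
    (hW : IsOpen W) (hF : ∀ i, ContDiffOn ℝ ∞ (F i) W)
    (ha : ContDiffOn ℝ ∞ a W) (hb : ContDiffOn ℝ ∞ b W)
    (h : ∀ q ∈ W, ∃ c k l k' l', IsConformalAt F a b q c k l k' l') {q : R4} (hq : q ∈ W) :
    pd 2 (pd 2 a) q = 0 ∧ pd 3 (pd 3 b) q = 0 := by
  have : ∀ q, ∃ c k l k' l', q ∈ W → IsConformalAt F a b q c k l k' l' := by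
    intro q
    by_cases hq : q ∈ W
    · obtain ⟨c, k, l, k', l', H⟩ := h q hq
      exact ⟨c, k, l, k', l', fun _ => H⟩
    · exact ⟨0, 0, 0, 0, 0, fun h => absurd h hq⟩
  choose c k l k' l' H using this
  have hc := fun q (hq : q ∈ W) => angle_pd_eq_zero hW hF H hq
  -- A zero differential makes the level sets of c open, so the angle may be frozen near q.
  have hN : IsOpen (W ∩ c ⁻¹' {c q}) := hW.isOpen_inter_preimage_of_fderiv_eq_zero
    (fun q hq => (hc q hq).differentiableAt.differentiableWithinAt) (fun q hq => (hc q hq).fderiv) _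
  set N := W ∩ c ⁻¹' {c q} with hNdef
  have hNW : N ⊆ W := Set.inter_subset_left
  have hqN : q ∈ N := ⟨hq, rfl⟩
  have D : ∀ i, ∀ q ∈ N, DifferentiableAt ℝ (F i) q := fun i q hq =>
    differentiableAt_of_contDiffOn hW (hF i) (hNW hq)
  have smooth : ∀ (s t : ℝ) i j, ContDiffOn ℝ ∞ (fun q => s * F i q + t * F j q) N := fun s t i j =>
    ((contDiffOn_const.mul (hF i)).add (contDiffOn_const.mul (hF j))).mono hNW
  have H' : ∀ z ∈ N, IsConformalAt F a b z (c q) (k z) (l z) (k' z) (l' z) := by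
    intro z hz
    have := H z (hNW hz)
    rwa [show c z = c q from hz.2] at this
  generalize c q = γ at H'
  have hcs := Real.sin_sq_add_cos_sq γ
  have hch := Real.cosh_sq γ
  constructor
  · have P2 : ∀ z ∈ N, pd 2 (F 0) z = k z * Real.sin γ ∧ pd 2 (F 2) z = k z * Real.cos γ := by
      intro z hz
      rw [(H' z hz).pd_p1, (H' z hz).pd_p1]
      simp [circVec]
    have P0 : ∀ z ∈ N, pd 0 (F 0) z + a z * pd 2 (F 0) z = k' z * Real.cos γ ∧
        pd 0 (F 2) z + a z * pd 2 (F 2) z = -(k' z * Real.sin γ) := by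
      intro z hz
      rw [(H' z hz).pd_x1, (H' z hz).pd_x1]
      simp [circVec, Real.sin_add_pi_div_two, Real.cos_add_pi_div_two]
    have EX : ∀ i, ∀ z ∈ N, pd i (fun q => Real.cos γ * F 0 q + (-Real.sin γ) * F 2 q) z = _ :=
      fun i z hz => pd_linearCombination (D 0 z hz) (D 2 z hz) _ _ i
    have EP : ∀ i, ∀ z ∈ N, pd i (fun q => Real.sin γ * F 0 q + Real.cos γ * F 2 q) z = _ :=
      fun i z hz => pd_linearCombination (D 0 z hz) (D 2 z hz) _ _ i
    -- X and P are the target coordinates rotated back by γ.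
    refine pd_pd_eq_zero (i := 0) (X := fun q => Real.cos γ * F 0 q + (-Real.sin γ) * F 2 q)
      (P := fun q => Real.sin γ * F 0 q + Real.cos γ * F 2 q) hN (smooth _ _ _ _)
      (smooth _ _ _ _) (ha.mono hNW) ?_ ?_ ?_ ?_ hqN
    · intro z hz
      rw [EX 2 z hz, (P2 z hz).1, (P2 z hz).2]; ring
    · intro z hz
      rw [EP 0 z hz, EP 2 z hz]
      linear_combination Real.sin γ * (P0 z hz).1 + Real.cos γ * (P0 z hz).2
    · intro z hz
      have e1 : pd 0 (fun q => Real.cos γ * F 0 q + (-Real.sin γ) * F 2 q) z = k' z := by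
        rw [EX 0 z hz]
        linear_combination Real.cos γ * (P0 z hz).1 - Real.sin γ * (P0 z hz).2
          - a z * Real.cos γ * (P2 z hz).1 + a z * Real.sin γ * (P2 z hz).2 + k' z * hcs
      have e2 : pd 2 (fun q => Real.sin γ * F 0 q + Real.cos γ * F 2 q) z = k z := by
        rw [EP 2 z hz, (P2 z hz).1, (P2 z hz).2]
        linear_combination k z * hcs
      rw [e1, e2]
      exact (H' z hz).k_sq
    · intro z hz
      rw [EP 2 z hz, (P2 z hz).1, (P2 z hz).2]
      convert (H' z hz).k_ne using 1
      linear_combination k z * hcs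
  · have P2 : ∀ z ∈ N, pd 3 (F 1) z = l z * Real.sinh γ ∧ pd 3 (F 3) z = l z * Real.cosh γ := by
      intro z hz
      rw [(H' z hz).pd_p2, (H' z hz).pd_p2]
      simp [hypVec]
    have P0 : ∀ z ∈ N, pd 1 (F 1) z + b z * pd 3 (F 1) z = l' z * Real.cosh γ ∧
        pd 1 (F 3) z + b z * pd 3 (F 3) z = l' z * Real.sinh γ := by
      intro z hz
      rw [(H' z hz).pd_x2, (H' z hz).pd_x2]
      simp
    have EX : ∀ i, ∀ z ∈ N, pd i (fun q => Real.cosh γ * F 1 q + (-Real.sinh γ) * F 3 q) z = _ :=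
      fun i z hz => pd_linearCombination (D 1 z hz) (D 3 z hz) _ _ i
    have EP : ∀ i, ∀ z ∈ N, pd i (fun q => -Real.sinh γ * F 1 q + Real.cosh γ * F 3 q) z = _ :=
      fun i z hz => pd_linearCombination (D 1 z hz) (D 3 z hz) _ _ i
    refine pd_pd_eq_zero (i := 1) (X := fun q => Real.cosh γ * F 1 q + (-Real.sinh γ) * F 3 q)
      (P := fun q => -Real.sinh γ * F 1 q + Real.cosh γ * F 3 q) hN (smooth _ _ _ _)
      (smooth _ _ _ _) (hb.mono hNW) ?_ ?_ ?_ ?_ hqN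
    · intro z hz
      rw [EX 3 z hz, (P2 z hz).1, (P2 z hz).2]; ring
    · intro z hz
      rw [EP 1 z hz, EP 3 z hz]
      linear_combination -Real.sinh γ * (P0 z hz).1 + Real.cosh γ * (P0 z hz).2
    · intro z hz
      have e1 : pd 1 (fun q => Real.cosh γ * F 1 q + (-Real.sinh γ) * F 3 q) z = l' z := by
        rw [EX 1 z hz]
        linear_combination Real.cosh γ * (P0 z hz).1 - Real.sinh γ * (P0 z hz).2
          - b z * Real.cosh γ * (P2 z hz).1 + b z * Real.sinh γ * (P2 z hz).2 + l' z * hch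
      have e2 : pd 3 (fun q => -Real.sinh γ * F 1 q + Real.cosh γ * F 3 q) z = l z := by
        rw [EP 3 z hz, (P2 z hz).1, (P2 z hz).2]
        linear_combination l z * hch
      rw [e1, e2]
      exact (H' z hz).l_sq
    · intro z hz
      rw [EP 3 z hz, (P2 z hz).1, (P2 z hz).2]
      convert (H' z hz).l_ne using 1
      linear_combination l z * hch

/-! ### Solutions of the system -/

section Invariance

variable {f : R4 → ℝ} {i : Fin 4}

theorem pd_eq_zero_of_invariant (h : ∀ (q : R4) (t : ℝ), f (q + t • basisVec i) = f q) (q : R4) :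
    pd i f q = 0 := by
  -- No smoothness is needed: `fderiv` is zero by convention where f is not differentiable.
  by_cases hd : DifferentiableAt ℝ f q
  · rw [pd, ← hd.lineDeriv_eq_fderiv, lineDeriv]
    simp [h]
  · simp [pd, fderiv_zero_of_not_differentiableAt hd]

theorem pd_invariant (h : ∀ (q : R4) (t : ℝ), f (q + t • basisVec i) = f q) (j : Fin 4) (q : R4)
    (t : ℝ) : pd j f (q + t • basisVec i) = pd j f q := by
  rw [pd, ← fderiv_comp_add_right, funext fun x => h x t, pd]

end Invariance

/-- Functions `u(x¹, p¹)` and `v(x², p²)` solve the system. -/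
theorem solvesCase3_of_invariant {u v : R4 → ℝ}
    (hu1 : ∀ (q : R4) (t : ℝ), u (q + t • basisVec 1) = u q)
    (hu3 : ∀ (q : R4) (t : ℝ), u (q + t • basisVec 3) = u q)
    (hv0 : ∀ (q : R4) (t : ℝ), v (q + t • basisVec 0) = v q)
    (hv2 : ∀ (q : R4) (t : ℝ), v (q + t • basisVec 2) = v q) (M : Set R4) :
    SolvesCase3 M u v := by
  have u1 : pd 1 u = fun _ => 0 := funext (pd_eq_zero_of_invariant hu1)
  have u3 : pd 3 u = fun _ => 0 := funext (pd_eq_zero_of_invariant hu3)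
  have v0 : pd 0 v = fun _ => 0 := funext (pd_eq_zero_of_invariant hv0)
  have v2 : pd 2 v = fun _ => 0 := funext (pd_eq_zero_of_invariant hv2)
  have u23 := pd_eq_zero_of_invariant (pd_invariant hu3 2)
  have u03 := pd_eq_zero_of_invariant (pd_invariant hu3 0)
  have v12 := pd_eq_zero_of_invariant (pd_invariant hv2 1)
  have c : ∀ i q, pd i (fun _ => 0) q = 0 := fun i q => by simp [pd]
  have r0 : rFun u v = fun _ => 0 := by
    funext q
    simp [rFun, v12, v0, v2, c, u3]
  have s0 : sFun u v = fun _ => 0 := by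
    funext q
    simp [sFun, u03, u1, u3, c, v2, u23]
  constructor <;> intro q _ <;> simp [r0, s0, c, u23, v2]

/-! ### Cones by equations -/

/-- The cone of `(u, v)` in terms of equations, if `u_{p²} = v_{p¹} = 0`. -/
theorem mem_coneOf {u v : R4 → ℝ} {q : R4} (hu : pd p2 u q = 0) (hv : pd p1 v q = 0) (w : R4) :
    w ∈ coneOf u v q ↔ InFlat
      (w - (w 0 * pd p1 u q) • basisVec 2 - (w 1 * pd p2 v q) • basisVec 3) := by
  have hu' : pd 3 u q = 0 := hu
  have hv' : pd 2 v q = 0 := hv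
  simp only [coneOf, Set.mem_ofPred_eq, InFlat]
  refine exists_congr fun τ => ?_
  rw [Submodule.mem_span_pair]
  constructor
  · rintro ⟨s, t, rfl⟩
    constructor <;> simp [Y0, Y1, basisVec, x1, x2, p1, p2, hu', hv'] <;> ring
  · rintro ⟨h1, h2⟩
    simp [basisVec, p1, p2] at h1 h2
    have hc := Real.sin_sq_add_cos_sq τ
    have hh := Real.cosh_sq τ
    -- The coefficients are the Euclidean and Lorentzian products of the unsheared vector with the
    -- unit vectors of the generator.
    refine ⟨w 0 * Real.sin τ + (w 2 - w 0 * pd 2 u q) * Real.cos τ,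
      (w 3 - w 1 * pd 3 v q) * Real.cosh τ - w 1 * Real.sinh τ, ?_⟩
    ext i; fin_cases i
    · simp [Y0, Y1, basisVec, x1, x2, p1, p2, hu', hv']
      linear_combination w 0 * hc - Real.cos τ * h1
    · simp [Y0, Y1, basisVec, x1, x2, p1, p2, hu', hv']
      linear_combination w 1 * hh - Real.cosh τ * h2
    · simp [Y0, Y1, basisVec, x1, x2, p1, p2, hu', hv']
      linear_combination w 2 * hc + (Real.sin τ - pd 2 u q * Real.cos τ) * h1
    · simp [Y0, Y1, basisVec, x1, x2, p1, p2, hu', hv']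
      linear_combination w 3 * hh - (Real.sinh τ + pd 3 v q * Real.cosh τ) * h2

theorem mem_coneOf_zero {q : R4} (w : R4) :
    w ∈ coneOf (fun _ => 0) (fun _ => 0) q ↔ InFlat w := by
  have c : ∀ i q, pd i (fun _ => 0) q = 0 := fun i q => by simp [pd]
  rw [mem_coneOf (c _ _) (c _ _), c, c]
  simp

/-! ### The cone of the linear system -/

section LinearSystem

variable {x y : ℝ → ℝ}

/-- Turning (x, ẋ) back by the flow gives two constants of motion, which are the initial data. -/
theorem solution_circ (hx : ContDiff ℝ 2 x) (h : ∀ t, deriv (deriv x) t = -x t) (t : ℝ) :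
    x t = x 0 * Real.cos t + deriv x 0 * Real.sin t := by
  have d0 : ∀ t, HasDerivAt x (deriv x t) t := fun t =>
    (hx.differentiable (by norm_num) t).hasDerivAt
  have d1 : ∀ t, HasDerivAt (deriv x) (-x t) t := fun t => by
    rw [← h]
    exact (((contDiff_succ_iff_deriv (n := 1)).1 hx).2.2.differentiable (by norm_num) t).hasDerivAt
  have e1 : ∀ t, HasDerivAt (fun t => x t * Real.cos t - deriv x t * Real.sin t) 0 t := fun t => by
    exact (((d0 t).mul (Real.hasDerivAt_cos t)).sub ((d1 t).mul (Real.hasDerivAt_sin t))).congr_deriv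
        (by ring)
  have e2 : ∀ t, HasDerivAt (fun t => x t * Real.sin t + deriv x t * Real.cos t) 0 t := fun t => by
    exact (((d0 t).mul (Real.hasDerivAt_sin t)).add ((d1 t).mul (Real.hasDerivAt_cos t))).congr_deriv
        (by ring)
  have c1 := is_const_of_deriv_eq_zero (fun t => (e1 t).differentiableAt) (fun t => (e1 t).deriv) t 0
  have c2 := is_const_of_deriv_eq_zero (fun t => (e2 t).differentiableAt) (fun t => (e2 t).deriv) t 0
  simp at c1 c2
  linear_combination Real.cos t * c1 + Real.sin t * c2 - x t * Real.sin_sq_add_cos_sq t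

theorem solution_hyp (hy : ContDiff ℝ 2 y) (h : ∀ t, deriv (deriv y) t = y t) (t : ℝ) :
    y t = y 0 * Real.cosh t + deriv y 0 * Real.sinh t := by
  have d0 : ∀ t, HasDerivAt y (deriv y t) t := fun t =>
    (hy.differentiable (by norm_num) t).hasDerivAt
  have d1 : ∀ t, HasDerivAt (deriv y) (y t) t := fun t => by
    rw [← h]
    exact (((contDiff_succ_iff_deriv (n := 1)).1 hy).2.2.differentiable (by norm_num) t).hasDerivAt
  have e1 : ∀ t, HasDerivAt (fun t => y t * Real.cosh t - deriv y t * Real.sinh t) 0 t :=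
    fun t => by
      exact (((d0 t).mul (Real.hasDerivAt_cosh t)).sub ((d1 t).mul (Real.hasDerivAt_sinh t))).congr_deriv
        (by ring)
  have e2 : ∀ t, HasDerivAt (fun t => deriv y t * Real.cosh t - y t * Real.sinh t) 0 t :=
    fun t => by
      exact (((d1 t).mul (Real.hasDerivAt_cosh t)).sub ((d0 t).mul (Real.hasDerivAt_sinh t))).congr_deriv
        (by ring)
  have c1 := is_const_of_deriv_eq_zero (fun t => (e1 t).differentiableAt) (fun t => (e1 t).deriv) t 0
  have c2 := is_const_of_deriv_eq_zero (fun t => (e2 t).differentiableAt) (fun t => (e2 t).deriv) t 0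
  simp at c1 c2
  linear_combination Real.cosh t * c1 + Real.sinh t * c2 - y t * Real.cosh_sq t

theorem hasDerivAt_circ (A B t : ℝ) :
    HasDerivAt (fun t => A * Real.cos t + B * Real.sin t)
      (B * Real.cos t + -A * Real.sin t) t := by
  exact (((Real.hasDerivAt_cos t).const_mul A).add ((Real.hasDerivAt_sin t).const_mul B)).congr_deriv
        (by ring)

theorem hasDerivAt_hyp (A B t : ℝ) :
    HasDerivAt (fun t => A * Real.cosh t + B * Real.sinh t)
      (B * Real.cosh t + A * Real.sinh t) t := by
  exact (((Real.hasDerivAt_cosh t).const_mul A).add ((Real.hasDerivAt_sinh t).const_mul B)).congr_deriv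
        (by ring)

/-- The solution with given initial data. -/
theorem isLinearSolution_of_initialData (q : R4) :
    IsLinearSolution (fun t => q 0 * Real.cos t + q 2 * Real.sin t)
      (fun t => q 1 * Real.cosh t + q 3 * Real.sinh t) := by
  refine ⟨by fun_prop, by fun_prop, fun t => ⟨?_, ?_⟩⟩
  · rw [funext fun t => (hasDerivAt_circ (q 0) (q 2) t).deriv, (hasDerivAt_circ _ _ t).deriv]
    ring
  · rw [funext fun t => (hasDerivAt_hyp (q 1) (q 3) t).deriv, (hasDerivAt_hyp _ _ t).deriv]

theorem initialData_eq (q : R4) :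
    initialData (fun t => q 0 * Real.cos t + q 2 * Real.sin t)
      (fun t => q 1 * Real.cosh t + q 3 * Real.sinh t) = q := by
  rw [initialData, (hasDerivAt_circ _ _ 0).deriv, (hasDerivAt_hyp _ _ 0).deriv]
  ext i; fin_cases i <;> simp

end LinearSystem

/-- The cone structure of the linear system is the flat one. -/
theorem coneOf_zero_eq_linearSystemCone :
    coneOf (fun _ => 0) (fun _ => 0) = linearSystemCone := by
  funext q
  ext w
  rw [mem_coneOf_zero]
  constructor
  · rintro ⟨τ, h1, h2⟩
    -- Solutions form a linear space, so the straight line q + εw suffices. The sign comes from w⁰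
    -- cos t₀ + w² sin t₀ = 0 at the meeting time.
    refine ⟨-τ, fun ε t => (q + ε • w) 0 * Real.cos t + (q + ε • w) 2 * Real.sin t,
      fun ε t => (q + ε • w) 1 * Real.cosh t + (q + ε • w) 3 * Real.sinh t,
      fun ε => isLinearSolution_of_initialData _, ?_, ?_, fun ε => ⟨?_, ?_⟩⟩
    · simp only [initialData_eq]; simp
    · simp only [initialData_eq]
      simpa using ((hasDerivAt_id (0 : ℝ)).smul_const w).const_add q
    · simp; linear_combination ε * h1
    · simp; linear_combination ε * h2
  · rintro ⟨t₀, x, y, hs, -, hd, ht⟩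
    have hd' := hasDerivAt_pi.1 hd
    have h0 : HasDerivAt (fun ε => x ε 0) (w 0) 0 := by simpa [initialData] using hd' 0
    have h1 : HasDerivAt (fun ε => y ε 0) (w 1) 0 := by simpa [initialData] using hd' 1
    have h2 : HasDerivAt (fun ε => deriv (x ε) 0) (w 2) 0 := by simpa [initialData] using hd' 2
    have h3 : HasDerivAt (fun ε => deriv (y ε) 0) (w 3) 0 := by simpa [initialData] using hd' 3
    have ex : (fun ε => x ε 0 * Real.cos t₀ + deriv (x ε) 0 * Real.sin t₀)
        = fun _ => x 0 t₀ := funext fun ε => by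
      rw [← solution_circ (hs ε).1 (fun t => ((hs ε).2.2 t).1) t₀]; exact (ht ε).1
    have ey : (fun ε => y ε 0 * Real.cosh t₀ + deriv (y ε) 0 * Real.sinh t₀)
        = fun _ => y 0 t₀ := funext fun ε => by
      rw [← solution_hyp (hs ε).2.1 (fun t => ((hs ε).2.2 t).2) t₀]; exact (ht ε).2
    have kx := (h0.mul_const (Real.cos t₀)).add (h2.mul_const (Real.sin t₀))
    have ky := (h1.mul_const (Real.cosh t₀)).add (h3.mul_const (Real.sinh t₀))
    have kx' := kx.unique (ex ▸ hasDerivAt_const (0 : ℝ) (x 0 t₀))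
    have ky' := ky.unique (ey ▸ hasDerivAt_const (0 : ℝ) (y 0 t₀))
    refine ⟨-t₀, ?_, ?_⟩
    · simp; linear_combination kx'
    · simp; linear_combination ky'

/-! ### From diffeomorphisms to conformal maps -/

/-- The shear `(x, p) ↦ (x, p + (a x¹, b x²))`. -/
noncomputable def shear (a b : ℝ) : R4 →ₗ[ℝ] R4 :=
  LinearMap.id + (LinearMap.proj 0).smulRight (a • basisVec 2)
    + (LinearMap.proj 1).smulRight (b • basisVec 3)

theorem shear_shear_neg (a b : ℝ) (w : R4) : shear a b (shear (-a) (-b) w) = w := by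
  ext i; fin_cases i <;> simp [shear, basisVec]

theorem inFlat_iff_shear {u v : R4 → ℝ} {q : R4} (hu : pd p2 u q = 0) (hv : pd p1 v q = 0)
    (w : R4) : shear (pd p1 u q) (pd p2 v q) w ∈ coneOf u v q ↔ InFlat w := by
  rw [mem_coneOf hu hv]
  have : shear (pd p1 u q) (pd p2 v q) w
      - (shear (pd p1 u q) (pd p2 v q) w 0 * pd p1 u q) • basisVec 2
      - (shear (pd p1 u q) (pd p2 v q) w 1 * pd p2 v q) • basisVec 3 = w := by
    ext i; fin_cases i <;> simp [shear, basisVec]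
  rw [this]

/-- A local diffeomorphism onto the flat cone structure is conformal. -/
theorem isConformalAt_of_image {u v : R4 → ℝ} {q : R4} (hu : pd p2 u q = 0) (hv : pd p1 v q = 0)
    {φ ψ : R4 → R4} (hφ : DifferentiableAt ℝ φ q) (hψ : DifferentiableAt ℝ ψ (φ q))
    (hl : ∀ᶠ z in nhds q, ψ (φ z) = z) (hr : ∀ᶠ z in nhds (φ q), φ (ψ z) = z)
    (hC : fderiv ℝ φ q '' coneOf u v q = {w | InFlat w}) :
    ∃ c k l k' l', IsConformalAt (fun i z => φ z i) (pd p1 u) (pd p2 v) q c k l k' l' := by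
  have hqq : ψ (φ q) = q := hl.self_of_nhds
  have hML : ∀ w, fderiv ℝ ψ (φ q) (fderiv ℝ φ q w) = w := by
    intro w
    have := (hψ.hasFDerivAt.comp q hφ.hasFDerivAt).unique ((hasFDerivAt_id q).congr_of_eventuallyEq hl)
    simpa using congrArg (fun T : R4 →L[ℝ] R4 => T w) this
  have hLM : ∀ w, fderiv ℝ φ q (fderiv ℝ ψ (φ q) w) = w := by
    intro w
    have h1 : HasFDerivAt φ (fderiv ℝ φ q) (ψ (φ q)) := by rw [hqq]; exact hφ.hasFDerivAt
    have := (h1.comp (φ q) hψ.hasFDerivAt).unique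
      ((hasFDerivAt_id (φ q)).congr_of_eventuallyEq hr)
    simpa using congrArg (fun T : R4 →L[ℝ] R4 => T w) this
  set a := pd p1 u q with ha
  set b := pd p2 v q with hb
  -- Precomposing the differential with the shear that carries the flat cone to the cone at q gives
  -- an automorphism of the flat cone.
  let L : R4 →ₗ[ℝ] R4 := (fderiv ℝ φ q : R4 →ₗ[ℝ] R4) ∘ₗ shear a b
  let M : R4 →ₗ[ℝ] R4 := shear (-a) (-b) ∘ₗ (fderiv ℝ ψ (φ q) : R4 →ₗ[ℝ] R4)
  have hL : ∀ w, InFlat (L w) ↔ InFlat w := by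
    intro w
    rw [← inFlat_iff_shear hu hv w]
    have : InFlat (L w) ↔ L w ∈ fderiv ℝ φ q '' coneOf u v q := by rw [hC]; rfl
    rw [this]
    constructor
    · rintro ⟨z, hz, hzw⟩
      have := congrArg (fderiv ℝ ψ (φ q)) hzw
      rw [hML] at this
      have h2 : fderiv ℝ ψ (φ q) (L w) = shear a b w := hML _
      rwa [this, h2] at hz
    · exact fun h => ⟨_, h, rfl⟩
  have hs : ∀ w, shear (-a) (-b) (shear a b w) = w := by
    intro w
    simpa using shear_shear_neg (-a) (-b) w
  have hML' : ∀ w, M (L w) = w := fun w => by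
    simp only [M, L, LinearMap.comp_apply, ContinuousLinearMap.coe_coe, hML, hs]
  have hLM' : ∀ w, L (M w) = w := fun w => by
    simp only [M, L, LinearMap.comp_apply, ContinuousLinearMap.coe_coe, shear_shear_neg, hLM]
  obtain ⟨c, k, l, k', l', hk, hl, hkk, hll, h2, h0, h3, h1⟩ :=
    exists_angle_of_automorphism hML' hLM' hL
  have hpd : ∀ i j, pd j (fun z => φ z i) q = fderiv ℝ φ q (basisVec j) i := by
    intro i j
    have := (hasFDerivAt_pi'.1 hφ.hasFDerivAt i).fderiv
    rw [pd, this]; rfl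
  have s2 : shear a b (basisVec 2) = basisVec 2 := by simp [shear, basisVec]
  have s3 : shear a b (basisVec 3) = basisVec 3 := by simp [shear, basisVec]
  have s0 : shear a b (basisVec 0) = basisVec 0 + a • basisVec 2 := by simp [shear, basisVec]
  have s1 : shear a b (basisVec 1) = basisVec 1 + b • basisVec 3 := by simp [shear, basisVec]
  simp only [L, LinearMap.comp_apply, ContinuousLinearMap.coe_coe, s0, s1, s2, s3, map_add,
    map_smul] at h0 h1 h2 h3
  refine ⟨c, k, l, k', l', hk, hl, hkk, hll, fun i => ?_, fun i => ?_, fun i => ?_, fun i => ?_⟩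
  · rw [hpd, h2]
  · rw [hpd, hpd, ← h0]; rfl
  · rw [hpd, h3]
  · rw [hpd, hpd, ← h1]; rfl

/-- If the cone structure of `u(x¹, p¹)`, `v(x², p²)` is flat, then the third derivatives
`u_{p¹p¹p¹}` and `v_{p²p²p²}` vanish. -/
theorem third_pd_eq_zero_of_flat {u v : R4 → ℝ} {W W' : Set R4} (hW : IsOpen W) (hW' : IsOpen W')
    (hu : ContDiffOn ℝ ∞ u W) (hv : ContDiffOn ℝ ∞ v W) (hu3 : ∀ q ∈ W, pd p2 u q = 0)
    (hv2 : ∀ q ∈ W, pd p1 v q = 0)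
    (h : ConesDiffeomorphic W (coneOf u v) W' linearSystemCone) {q : R4} (hq : q ∈ W) :
    pd p1 (pd p1 (pd p1 u)) q = 0 ∧ pd p2 (pd p2 (pd p2 v)) q = 0 := by
  obtain ⟨φ, ψ, hφ, hψ, hm, -, hl, hr, hC⟩ := h
  refine pd_pd_eq_zero_of_conformal (F := fun i z => φ z i) hW (fun i => contDiffOn_pi.1 hφ i)
    (pd_contDiffOn hW hu _) (pd_contDiffOn hW hv _) (fun q hq => ?_) hq
  refine isConformalAt_of_image (ψ := ψ) (hu3 q hq) (hv2 q hq)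
    ((hφ.contDiffAt (hW.mem_nhds hq)).differentiableAt (by simp))
    ((hψ.contDiffAt (hW'.mem_nhds (hm hq))).differentiableAt (by simp))
    (Filter.eventually_of_mem (hW.mem_nhds hq) hl)
    (Filter.eventually_of_mem (hW'.mem_nhds (hm hq)) hr) ?_
  rw [hC q hq, ← coneOf_zero_eq_linearSystemCone]
  ext w
  exact mem_coneOf_zero w

end ConeGeom

/-! ### The main theorem -/

theorem mainTheorem4
    (U V : Set (ℝ × ℝ)) (hU : IsOpen U) (hV : IsOpen V)
    (f g : ℝ × ℝ → ℝ) (hf : ContDiffOn ℝ ∞ f U) (hg : ContDiffOn ℝ ∞ g V)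
    (M : Set ConeGeom.R4)
    (hM : M = {q | (q ConeGeom.x1, q ConeGeom.p1) ∈ U ∧ (q ConeGeom.x2, q ConeGeom.p2) ∈ V})
    (u v : ConeGeom.R4 → ℝ)
    (hu : u = fun q => f (q ConeGeom.x1, q ConeGeom.p1))
    (hv : v = fun q => g (q ConeGeom.x2, q ConeGeom.p2)) :
    -- `u(x¹,p¹)` and `v(x²,p²)` solve the system
    ConeGeom.SolvesCase3 M u v ∧
    -- the flat cone structure, `u = v = 0`, is the one defined by the linear system
    ConeGeom.coneOf (fun _ => 0) (fun _ => 0) = ConeGeom.linearSystemCone ∧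
    -- non-flatness, on every open set with a point where a third derivative is nonzero
    ∀ W : Set ConeGeom.R4, IsOpen W → W ⊆ M →
      (∃ q ∈ W,
        ConeGeom.pd ConeGeom.p1 (ConeGeom.pd ConeGeom.p1 (ConeGeom.pd ConeGeom.p1 u)) q ≠ 0 ∨
        ConeGeom.pd ConeGeom.p2 (ConeGeom.pd ConeGeom.p2 (ConeGeom.pd ConeGeom.p2 v)) q ≠ 0) →
      ∀ W' : Set ConeGeom.R4, IsOpen W' →
        ¬ ConeGeom.ConesDiffeomorphic W (ConeGeom.coneOf u v) W' ConeGeom.linearSystemCone := by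
  have hu1 : ∀ (q : ConeGeom.R4) (t : ℝ), u (q + t • ConeGeom.basisVec 1) = u q := by
    intro q t; simp [hu, ConeGeom.basisVec, ConeGeom.x1, ConeGeom.p1]
  have hu3 : ∀ (q : ConeGeom.R4) (t : ℝ), u (q + t • ConeGeom.basisVec 3) = u q := by
    intro q t; simp [hu, ConeGeom.basisVec, ConeGeom.x1, ConeGeom.p1]
  have hv0 : ∀ (q : ConeGeom.R4) (t : ℝ), v (q + t • ConeGeom.basisVec 0) = v q := by
    intro q t; simp [hv, ConeGeom.basisVec, ConeGeom.x2, ConeGeom.p2]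
  have hv2 : ∀ (q : ConeGeom.R4) (t : ℝ), v (q + t • ConeGeom.basisVec 2) = v q := by
    intro q t; simp [hv, ConeGeom.basisVec, ConeGeom.x2, ConeGeom.p2]
  refine ⟨ConeGeom.solvesCase3_of_invariant hu1 hu3 hv0 hv2 M,
    ConeGeom.coneOf_zero_eq_linearSystemCone, ?_⟩
  rintro W hW hWM ⟨q, hq, hne⟩ W' hW' hdiff
  have hus : ContDiffOn ℝ ∞ u W := by
    rw [hu]
    refine hf.comp (t := U) (f := fun q : ConeGeom.R4 => (q ConeGeom.x1, q ConeGeom.p1))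
      (by fun_prop) fun z hz => ?_
    have := hWM hz
    rw [hM] at this
    exact this.1
  have hvs : ContDiffOn ℝ ∞ v W := by
    rw [hv]
    refine hg.comp (t := V) (f := fun q : ConeGeom.R4 => (q ConeGeom.x2, q ConeGeom.p2))
      (by fun_prop) fun z hz => ?_
    have := hWM hz
    rw [hM] at this
    exact this.2
  have h := ConeGeom.third_pd_eq_zero_of_flat hW hW' hus hvs
    (fun q _ => ConeGeom.pd_eq_zero_of_invariant hu3 q)
    (fun q _ => ConeGeom.pd_eq_zero_of_invariant hv2 q) hdiff hq
  exact hne.elim (fun h' => h' h.1) (fun h' => h' h.2)
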